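/- Let $\mathbb{K}$ be an algebraically closed field of characteristic $0$. A subvariety of $\mathbb{P}^n=\mathbb{P}^n_{\mathbb{K}}$ is an irreducible (hence non-empty) Zariski closed subset. For subvarieties $X,Y\subseteq\mathbb{P}^n$ the Hadamard product $X\star Y\subseteq\mathbb{P}^n$ is the Zariski closure of the set of all points $[p_0q_0:\dots:p_nq_n]$ with $[p_0:\dots:p_n]\in X$, $[q_0:\dots:q_n]\in Y$ and $p_iq_i\neq 0$ for at least one $i$. For a Zariski closed set $V\subseteq\mathbb{P}^n$ with homogeneous ideal $I(V)\subseteq S=\mathbb{K}[x_0,\dots,x_n]$, let $HF_V(t)=\dim_{\mathbb{K}}(S/I(V))_t$ be its Hilbert function, $\dim V$ its dimension as a topological space, and $\deg V$ its degree, i.e. $(\dim V)!$ times the leading coefficient of its Hilbert polynomial. Let $n,h,k\geq 0$ be integers with $n\geq (h+1)(k+1)-1$, and let $L_h$ and $L_k$ be generic linear subspaces of $\mathbb{P}^n$ of dimensions $h$ and $k$ respectively; that is, the following holds for all pairs $(L_h,L_k)$ in some non-empty Zariski open subset, depending only on $\mathbb{K},n,h,k$, of the product of the two Grassmannians. Let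 $X\subseteq L_h$ be a subvariety of dimension $r$ and degree $d_X$, and let $Y\subseteq L_k$ be a subvariety of dimension $s$ and degree $d_Y$. Then \begin{enumerate} \item[i)] $\dim(X\star Y)=r+s$; \item[ii)] $\deg(X\star Y)=\binom{r+s}{s}\,d_X\,d_Y$; \item[iii)] $HF_{X\star Y}(t)=HF_X(t)\cdot HF_Y(t)$ for all integers $t\geq 0$. \end{enumerate} -/

import Mathlib

open MvPolynomial Filter

noncomputable section

namespace HadamardProj

/-- Projective `n`-space over `K`: the lines of `K^(n+1)`. -/
abbrev PSpace (K : Type*) [Field K] (n : ℕ) : Type _ :=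
  Projectivization K (Fin (n + 1) → K)

/-- The polynomial `f` is a form, i.e. homogeneous of some degree. -/
def IsForm {K : Type*} [Field K] {n : ℕ} (f : MvPolynomial (Fin (n + 1)) K) : Prop :=
  ∃ d : ℕ, f.IsHomogeneous d

/-- The common zeros in projective space of a set `T` of forms. (For a form, vanishing at a point
does not depend on the representative.) -/
def zeros {K : Type*} [Field K] {n : ℕ} (T : Set (MvPolynomial (Fin (n + 1)) K)) :
    Set (PSpace K n) :=
  {p | ∀ f ∈ T, eval p.rep f = 0}

/-- The Zariski topology on projective space: the closed sets are the common zeros of sets of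
forms. -/
instance zariskiTopology (K : Type*) [Field K] (n : ℕ) : TopologicalSpace (PSpace K n) :=
  TopologicalSpace.ofClosed
    {Z | ∃ T : Set (MvPolynomial (Fin (n + 1)) K), (∀ f ∈ T, IsForm f) ∧ Z = zeros T}
    (by
      refine ⟨{1}, ?_, ?_⟩
      · rintro f rfl
        exact ⟨0, isHomogeneous_one _ _⟩
      · ext p
        simp [zeros])
    (by
      intro A hA
      refine ⟨{f | IsForm f ∧ ∃ Z ∈ A, ∀ p ∈ Z, eval p.rep f = 0}, fun f hf => hf.1, ?_⟩
      ext p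
      constructor
      · rintro hp f ⟨-, Z, hZ, hfZ⟩
        exact hfZ p (hp Z hZ)
      · intro hp Z hZ
        obtain ⟨T, hT, hZT⟩ := hA hZ
        rw [hZT]
        intro f hf
        refine hp f ⟨hT f hf, Z, hZ, fun q hq => ?_⟩
        rw [hZT] at hq
        exact hq f hf)
    (by
      rintro _ ⟨S, hS, rfl⟩ _ ⟨T, hT, rfl⟩
      refine ⟨{f | ∃ a ∈ S, ∃ b ∈ T, f = a * b}, ?_, ?_⟩
      · rintro _ ⟨a, ha, b, hb, rfl⟩
        obtain ⟨d, hd⟩ := hS a ha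
        obtain ⟨e, he⟩ := hT b hb
        exact ⟨d + e, hd.mul he⟩
      · ext p
        constructor
        · rintro (hp | hp) _ ⟨a, ha, b, hb, rfl⟩
          · simp [hp a ha]
          · simp [hp b hb]
        · intro hp
          by_contra hcon
          have h1 : p ∉ zeros S := fun h => hcon (Or.inl h)
          have h2 : p ∉ zeros T := fun h => hcon (Or.inr h)
          simp only [zeros, Set.mem_ofPred_eq, not_forall] at h1 h2
          obtain ⟨a, ha, ha0⟩ := h1
          obtain ⟨b, hb, hb0⟩ := h2
          have h3 := hp (a * b) ⟨a, ha, b, hb, rfl⟩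
          rw [map_mul] at h3
          exact (mul_ne_zero ha0 hb0) h3)

/-- A projective (sub)variety: an irreducible (in particular non-empty) Zariski closed subset of
projective space. -/
def IsVariety {K : Type*} [Field K] {n : ℕ} (X : Set (PSpace K n)) : Prop :=
  IsClosed X ∧ IsIrreducible X

/-- The homogeneous ideal of `X`: generated by the forms that vanish on `X`. -/
def homogeneousIdeal {K : Type*} [Field K] {n : ℕ} (X : Set (PSpace K n)) :
    Ideal (MvPolynomial (Fin (n + 1)) K) :=
  Ideal.span {f | IsForm f ∧ ∀ p ∈ X, eval p.rep f = 0}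

/-- The homogeneous coordinate ring of `X`. -/
abbrev CoordRing {K : Type*} [Field K] {n : ℕ} (X : Set (PSpace K n)) : Type _ :=
  MvPolynomial (Fin (n + 1)) K ⧸ homogeneousIdeal X

/-- The degree `t` graded piece of the homogeneous coordinate ring: the classes of the forms of
degree `t`. -/
def gradedPiece {K : Type*} [Field K] {n : ℕ} (X : Set (PSpace K n)) (t : ℕ) :
    Submodule K (CoordRing X) :=
  (homogeneousSubmodule (Fin (n + 1)) K t).map
    (Ideal.Quotient.mkₐ K (homogeneousIdeal X)).toLinearMap

/-- The Hilbert function of (the homogeneous coordinate ring of) `X`. -/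
def HF {K : Type*} [Field K] {n : ℕ} (X : Set (PSpace K n)) (t : ℕ) : ℕ :=
  Module.finrank K (gradedPiece X t)

/-- The Hilbert polynomial of `X`: the polynomial that agrees with the Hilbert function at all
large integers. -/
def hilbertPolynomial {K : Type*} [Field K] {n : ℕ} (X : Set (PSpace K n)) : Polynomial ℚ :=
  Classical.epsilon fun P : Polynomial ℚ => ∀ᶠ t : ℕ in atTop, (HF X t : ℚ) = P.eval (t : ℚ)

/-- The dimension of `X` as a topological space, with the Zariski topology. -/
def dim {K : Type*} [Field K] {n : ℕ} (X : Set (PSpace K n)) : WithBot ℕ∞ :=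
  topologicalKrullDim X

/-- The degree of `X`: `(dim X)!` times the leading coefficient of the Hilbert polynomial. -/
def degree {K : Type*} [Field K] {n : ℕ} (X : Set (PSpace K n)) : ℚ :=
  (((dim X).unbotD 0).toNat.factorial : ℚ) * (hilbertPolynomial X).leadingCoeff

/-- The Hadamard product of two subsets of projective space: the Zariski closure of the set of the
coordinatewise products `p ⋆ q` with `p ∈ X`, `q ∈ Y`, taken over the pairs for which `p ⋆ q` is
defined, i.e. for which the coordinatewise products are not all zero. -/
def hadamard {K : Type*} [Field K] {n : ℕ} (X Y : Set (PSpace K n)) : Set (PSpace K n) :=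
  closure {z | ∃ p ∈ X, ∃ q ∈ Y, ∃ h : p.rep * q.rep ≠ 0,
    z = Projectivization.mk K (p.rep * q.rep) h}

/-- The linear subspace of projective space given by a vector subspace `L`. -/
def linearSubspace {K : Type*} [Field K] {n : ℕ} (L : Submodule K (Fin (n + 1) → K)) :
    Set (PSpace K n) :=
  {p | p.submodule ≤ L}

/-- The column space of a matrix. -/
def colSpace {K : Type*} [Field K] {n m : ℕ} (A : Matrix (Fin (n + 1)) (Fin m) K) :
    Submodule K (Fin (n + 1) → K) :=
  Submodule.span K (Set.range A.col)

/-- `P L L'` holds for generic linear subspaces `L`, `L'` of projective `n`-space of dimensions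
`h` and `k`: there is a non-zero polynomial `F` in the coefficients of a pair of linear
parameterizations such that `P` holds for all pairs of such subspaces that are parameterized by
injective `A`, `B` with `F (A, B) ≠ 0`. Over an infinite field this says that `P` holds on a
non-empty Zariski open subset of the product of the two Grassmannians. -/
def ForGenericPair (K : Type*) [Field K] (n h k : ℕ)
    (P : Set (PSpace K n) → Set (PSpace K n) → Prop) : Prop :=
  ∃ F : MvPolynomial ((Fin (n + 1) × Fin (h + 1)) ⊕ (Fin (n + 1) × Fin (k + 1))) K, F ≠ 0 ∧
    ∀ (A : Matrix (Fin (n + 1)) (Fin (h + 1)) K) (B : Matrix (Fin (n + 1)) (Fin (k + 1)) K),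
      LinearIndependent K A.col → LinearIndependent K B.col →
      eval (Sum.elim (fun ij => A ij.1 ij.2) (fun ij => B ij.1 ij.2)) F ≠ 0 →
      P (linearSubspace (colSpace A)) (linearSubspace (colSpace B))

end HadamardProj

end

/-!
The forms of degree `t` restrict to a family of vectors as the `t`-th power, inside the algebra of
functions on the family, of the span of the coordinate functions; so `HF X t` is the dimension of
`V_X ^ t`, where `V_X` is spanned by the coordinates of the points of `X`. For generic `A` and `B`
the products of a column of `A` with a column of `B` are linearly independent, so every bilinear
form on the pair of column spaces is a linear form in the coordinatewise product. Hence
`V_{X ⋆ Y}`, as a space of functions on `X × Y`, is the product of the pullbacks of `V_X` and `V_Y`.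
Functions of the first variable are linearly disjoint from functions of the second, and the
Hilbert function is multiplicative.

The Hilbert polynomial is therefore multiplicative too, and it determines the dimension and the
degree, because the dimension of a variety is the degree of its Hilbert polynomial. Strict
monotonicity of that degree along chains of homogeneous primes gives one inequality. For the other,
cut with a coordinate hyperplane not containing the variety: the Hilbert polynomial drops by exactly
one degree, and the degree that remains is attained at some homogeneous prime over the section.
-/

open MvPolynomial Filter

noncomputable section

namespace HadamardProj

section PolynomialGrowth

open Polynomial

theorem eq_of_eventually_eval_eq {R : Type*} [CommRing R] [IsDomain R] [CharZero R] {P Q : R[X]}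
    (h : ∀ᶠ t : ℕ in atTop, P.eval (t : R) = Q.eval (t : R)) : P = Q := by
  obtain ⟨N, hN⟩ := eventually_atTop.1 h
  refine eq_of_infinite_eval_eq P Q
    (((Set.Ici_infinite N).image Nat.cast_injective.injOn).mono ?_)
  rintro _ ⟨t, ht, rfl⟩
  exact hN t ht

theorem degree_le_of_eventually_eval_le {𝕜 : Type*} [NormedField 𝕜] [LinearOrder 𝕜]
    [IsStrictOrderedRing 𝕜] [OrderTopology 𝕜] [Archimedean 𝕜] {P R : 𝕜[X]}
    (hP : ∀ᶠ t : ℕ in atTop, 0 ≤ P.eval (t : 𝕜))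
    (hPR : ∀ᶠ t : ℕ in atTop, P.eval (t : 𝕜) ≤ R.eval (t : 𝕜)) : P.degree ≤ R.degree := by
  by_contra! hRP
  have hcast : Tendsto (Nat.cast : ℕ → 𝕜) atTop atTop := tendsto_natCast_atTop_atTop
  have hquot : ∀ᶠ t : ℕ in atTop, R.eval (t : 𝕜) / P.eval (t : 𝕜) < 1 :=
    ((div_tendsto_atTop_zero_of_degree_lt R P hRP).comp hcast).eventually_lt_const one_pos
  have hroot : ∀ᶠ t : ℕ in atTop, ¬P.IsRoot (t : 𝕜) :=
    hcast.eventually (eventually_atTop_not_isRoot P (ne_zero_of_degree_gt hRP))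
  obtain ⟨t, hPt, hPRt, hquot_t, hroot_t⟩ := (hP.and (hPR.and (hquot.and hroot))).exists
  rw [div_lt_one (lt_of_le_of_ne hPt (Ne.symm hroot_t))] at hquot_t
  exact hquot_t.not_ge hPRt

theorem exists_taylor_one_sub_self (P : ℚ[X]) : ∃ Q : ℚ[X], taylor 1 Q - Q = P := by
  induction P using Polynomial.induction_on' with
  | add p q hp hq =>
    obtain ⟨a, rfl⟩ := hp
    obtain ⟨b, rfl⟩ := hq
    exact ⟨a + b, by rw [map_add]; ring⟩
  | monomial m c =>
    -- The Bernoulli polynomials satisfy `B (m + 1) (x + 1) - B (m + 1) x = (m + 1) * x ^ m`.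
    refine ⟨Polynomial.C (c / (m + 1)) * Polynomial.bernoulli (m + 1), ?_⟩
    have hc : Polynomial.C c = Polynomial.C (c / (m + 1)) * Polynomial.C ((m : ℚ) + 1) := by
      rw [← Polynomial.C_mul, div_mul_cancel₀ _ (by positivity)]
    have hB := bernoulli_comp_one_add_X (m + 1)
    rw [taylor_apply, mul_comp, C_comp, Polynomial.C_1, add_comm Polynomial.X, hB,
      ← Polynomial.C_mul_X_pow_eq_monomial, hc]
    simp only [add_tsub_cancel_right, map_add, map_natCast, map_one]
    ring

theorem exists_polynomial_of_eventually_sub_eq {F : ℕ → ℚ} {P : ℚ[X]}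
    (hF : ∀ᶠ t : ℕ in atTop, F (t + 1) - F t = P.eval (t : ℚ)) :
    ∃ Q : ℚ[X], ∀ᶠ t : ℕ in atTop, F t = Q.eval (t : ℚ) := by
  obtain ⟨Q, rfl⟩ := exists_taylor_one_sub_self P
  obtain ⟨N, hN⟩ := eventually_atTop.1 hF
  refine ⟨Q + Polynomial.C (F N - Q.eval (N : ℚ)), ?_⟩
  filter_upwards [eventually_ge_atTop N] with t ht
  induction t, ht using Nat.le_induction with
  | base => simp
  | succ t ht ih =>
    have hstep := hN t ht
    simp only [Polynomial.eval_add, Polynomial.eval_sub, taylor_eval, Polynomial.eval_C]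
      at ih hstep ⊢
    push_cast
    linarith

theorem degree_sub_taylor_lt {R : Type*} [CommRing R] {P : R[X]} (hP : P ≠ 0) (a : R) :
    (P - taylor a P).degree < P.degree :=
  degree_sub_lt_left (degree_taylor P a).symm hP (leadingCoeff_taylor a P).symm

theorem coeff_sub_taylor {R : Type*} [CommRing R] {P : R[X]} {d : ℕ} (hd : P.natDegree = d + 1)
    (a : R) : (P - taylor a P).coeff d = -((d + 1) * P.leadingCoeff * a) := by
  have hderiv : (hasseDeriv d P).natDegree < 2 := by
    have := natDegree_hasseDeriv_le P d
    lia
  rw [Polynomial.coeff_sub, taylor_coeff, eval_eq_sum_range' hderiv]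
  simp [Finset.sum_range_succ, hasseDeriv_coeff, leadingCoeff, hd, add_comm 1 d]

end PolynomialGrowth

section LinearAlgebra

variable {K V W W' : Type*} [Field K] [AddCommGroup V] [Module K V] [AddCommGroup W] [Module K W]
  [AddCommGroup W'] [Module K W']

theorem finrank_map_eq_finrank_map_of_ker_eq {N : Submodule K V} {φ : V →ₗ[K] W}
    {ψ : V →ₗ[K] W'} (h : ∀ x ∈ N, φ x = 0 ↔ ψ x = 0) :
    Module.finrank K (N.map φ) = Module.finrank K (N.map ψ) := by
  have hker : LinearMap.ker (φ.domRestrict N) = LinearMap.ker (ψ.domRestrict N) := by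
    ext x
    exact h x x.2
  rw [← LinearMap.range_domRestrict, ← LinearMap.range_domRestrict,
    ← (φ.domRestrict N).quotKerEquivRange.finrank_eq, hker,
    (ψ.domRestrict N).quotKerEquivRange.finrank_eq]

theorem finrank_map_add_finrank_inf_ker (N : Submodule K V) [Module.Finite K N] (φ : V →ₗ[K] W) :
    Module.finrank K (N.map φ) + Module.finrank K ↥(N ⊓ LinearMap.ker φ) =
      Module.finrank K N := by
  rw [← (φ.domRestrict N).finrank_range_add_finrank_ker, LinearMap.range_domRestrict,
    LinearMap.ker_domRestrict, ← Submodule.map_comap_subtype,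
    (Submodule.equivMapOfInjective _ N.injective_subtype _).finrank_eq]

end LinearAlgebra

section HomogeneousIdeals

variable {ι σ A : Type*} [CommRing A] [SetLike σ A]

theorem colon_singleton_eq_self_of_isPrime {I : Ideal A} [hI : I.IsPrime] {f : A} (hf : f ∉ I) :
    I.colon {f} = I := by
  ext u
  rw [Submodule.mem_colon_singleton, smul_eq_mul]
  exact ⟨fun h => (hI.mem_or_mem h).resolve_right hf, fun h => I.mul_mem_right _ h⟩

theorem lt_sup_span_singleton {I : Ideal A} {f : A} (hf : f ∉ I) : I < I ⊔ Ideal.span {f} :=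
  left_lt_sup.2 fun h => hf (h (Ideal.mem_span_singleton_self f))

variable [AddSubgroupClass σ A] {𝒜 : ι → σ}

theorem isHomogeneous_span_singleton [DecidableEq ι] [AddMonoid ι] [GradedRing 𝒜] {f : A}
    {e : ι} (hf : f ∈ 𝒜 e) : (Ideal.span {f}).IsHomogeneous 𝒜 :=
  Ideal.homogeneous_span 𝒜 _ (by rintro _ rfl; exact ⟨e, hf⟩)

theorem isHomogeneous_colon_singleton [DecidableEq ι] [AddLeftCancelMonoid ι] [GradedRing 𝒜]
    {I : Ideal A} (hI : I.IsHomogeneous 𝒜) {f : A} {e : ι} (hf : f ∈ 𝒜 e) :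
    (I.colon {f}).IsHomogeneous 𝒜 := by
  intro d u hu
  rw [Submodule.mem_colon_singleton, smul_eq_mul, mul_comm] at hu ⊢
  rw [← DirectSum.coe_decompose_mul_add_of_left_mem 𝒜 hf]
  exact hI _ hu

theorem exists_homogeneous_notMem_of_lt [DecidableEq ι] [AddMonoid ι] [GradedRing 𝒜]
    {I J : Ideal A} (hJ : J.IsHomogeneous 𝒜) (hIJ : I < J) :
    ∃ e, ∃ f ∈ 𝒜 e, f ∈ J ∧ f ∉ I := by
  classical
  obtain ⟨g, hgJ, hgI⟩ : ∃ g ∈ J, g ∉ I := SetLike.exists_of_lt hIJ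
  contrapose! hgI
  rw [← DirectSum.sum_support_decompose 𝒜 g]
  exact sum_mem fun e _ => hgI e _ (SetLike.coe_mem _) (hJ e hgJ)

/-- Noetherian induction along the exact sequences
`0 → A / (I : f) → A / I → A / (I + (f)) → 0` with `f` homogeneous, which reduce the proof of an
additive property to homogeneous primes. -/
theorem isHomogeneous_induction [AddCancelCommMonoid ι] [LinearOrder ι]
    [IsOrderedCancelAddMonoid ι] [GradedRing 𝒜] [IsNoetherianRing A]
    {motive : ∀ I : Ideal A, I.IsHomogeneous 𝒜 → Prop}
    (top : motive ⊤ (Ideal.IsHomogeneous.top 𝒜))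
    (prime : ∀ (P : Ideal A) (hP : P.IsHomogeneous 𝒜), P.IsPrime →
      (∀ (J : Ideal A) (hJ : J.IsHomogeneous 𝒜), P < J → motive J hJ) → motive P hP)
    (step : ∀ (I : Ideal A) (hI : I.IsHomogeneous 𝒜) (e : ι) (f : A) (hf : f ∈ 𝒜 e),
      motive (I.colon {f}) (isHomogeneous_colon_singleton hI hf) →
      motive (I ⊔ Ideal.span {f}) (hI.sup (isHomogeneous_span_singleton hf)) → motive I hI)
    {I : Ideal A} (hI : I.IsHomogeneous 𝒜) : motive I hI := by
  induction I using WellFoundedGT.induction with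
  | ind I ih =>
  by_cases htop : I = ⊤
  · subst htop
    exact top
  by_cases hprime : I.IsPrime
  · exact prime I hI hprime fun J hJ hIJ => ih J hIJ hJ
  obtain ⟨f, g, ⟨e, hf⟩, -, hfg, hfI, hgI⟩ : ∃ f g : A, SetLike.IsHomogeneousElem 𝒜 f ∧
      SetLike.IsHomogeneousElem 𝒜 g ∧ f * g ∈ I ∧ f ∉ I ∧ g ∉ I := by
    contrapose! hprime
    refine hI.isPrime_of_homogeneous_mem_or_mem htop fun {x y} hx hy hxy => ?_
    exact or_iff_not_imp_left.2 (hprime x y hx hy hxy)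
  have hcolon : I < I.colon {f} := by
    refine lt_of_le_of_ne Ideal.le_colon fun h => hgI ?_
    rwa [h, Submodule.mem_colon_singleton, smul_eq_mul, mul_comm]
  exact step I hI e f hf (ih _ hcolon _) (ih _ (lt_sup_span_singleton hfI) _)

end HomogeneousIdeals

section HilbertFunction

variable {K A : Type*} [Field K] [CommRing A] [Algebra K A] (𝒜 : ℕ → Submodule K A)

/-- The Hilbert function of `A ⧸ I`, for an ideal `I` of a graded `K`-algebra `A`: the dimension
of the space of classes of the homogeneous elements of degree `t`. -/
def hilbertFunction (I : Ideal A) (t : ℕ) : ℕ :=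
  Module.finrank K ((𝒜 t).map (Ideal.Quotient.mkₐ K I).toLinearMap)

variable {𝒜}

theorem mkₐ_toLinearMap_eq_zero_iff {I : Ideal A} {a : A} :
    (Ideal.Quotient.mkₐ K I).toLinearMap a = 0 ↔ a ∈ I :=
  Ideal.Quotient.eq_zero_iff_mem

theorem hilbertFunction_eq_finrank_map {M : Type*} [AddCommGroup M] [Module K M] {I : Ideal A}
    {t : ℕ} (φ : A →ₗ[K] M) (hφ : ∀ a ∈ 𝒜 t, φ a = 0 ↔ a ∈ I) :
    hilbertFunction 𝒜 I t = Module.finrank K ((𝒜 t).map φ) :=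
  finrank_map_eq_finrank_map_of_ker_eq fun a ha =>
    mkₐ_toLinearMap_eq_zero_iff.trans (hφ a ha).symm

theorem hilbertFunction_eq_zero {I : Ideal A} {t : ℕ} (h : ∀ a ∈ 𝒜 t, a ∈ I) :
    hilbertFunction 𝒜 I t = 0 := by
  rw [hilbertFunction_eq_finrank_map (0 : A →ₗ[K] K) fun a ha => by simp [h a ha],
    Submodule.map_zero, finrank_bot]

theorem hilbertFunction_pos {I : Ideal A} {t : ℕ} [Module.Finite K (𝒜 t)] {a : A}
    (ha : a ∈ 𝒜 t) (haI : a ∉ I) : 0 < hilbertFunction 𝒜 I t := by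
  refine Module.finrank_pos_iff_exists_ne_zero.2 ⟨⟨_, Submodule.mem_map_of_mem ha⟩, fun h => haI ?_⟩
  exact mkₐ_toLinearMap_eq_zero_iff.1 (congrArg Subtype.val h)

theorem hilbertFunction_anti {I J : Ideal A} (hIJ : I ≤ J) (t : ℕ) [Module.Finite K (𝒜 t)] :
    hilbertFunction 𝒜 J t ≤ hilbertFunction 𝒜 I t := by
  rw [hilbertFunction, ← Ideal.Quotient.factorₐ_comp_mk K hIJ, AlgHom.comp_toLinearMap,
    Submodule.map_comp]
  exact Submodule.finrank_map_le _ _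

variable [GradedAlgebra 𝒜]

theorem map_mkₐ_mulLeft {I : Ideal A} (hI : I.IsHomogeneous 𝒜) {f : A} {e : ℕ} (hf : f ∈ 𝒜 e)
    (t : ℕ) :
    (𝒜 t).map ((Ideal.Quotient.mkₐ K I).toLinearMap ∘ₗ LinearMap.mulLeft K f) =
      (𝒜 (e + t)).map (Ideal.Quotient.mkₐ K I).toLinearMap ⊓
        LinearMap.ker (Ideal.Quotient.factorₐ K
          (le_sup_left : I ≤ I ⊔ Ideal.span {f})).toLinearMap := by
  apply le_antisymm
  · rintro _ ⟨g, hg, rfl⟩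
    refine ⟨Submodule.mem_map_of_mem (SetLike.mul_mem_graded hf hg), ?_⟩
    exact Ideal.Quotient.eq_zero_iff_mem.2
      (Ideal.mem_sup_right (Ideal.mul_mem_right g _ (Ideal.mem_span_singleton_self f)))
  · rintro _ ⟨⟨a, ha, rfl⟩, hker⟩
    obtain ⟨i, hi, y, hy, hiy⟩ := Submodule.mem_sup.1 (Ideal.Quotient.eq_zero_iff_mem.1 hker)
    obtain ⟨u, rfl⟩ := Ideal.mem_span_singleton.1 hy
    have hcomponent : a = DirectSum.decompose 𝒜 i (e + t) + f * DirectSum.decompose 𝒜 u t := by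
      rw [← DirectSum.coe_decompose_mul_add_of_left_mem 𝒜 hf, ← Submodule.coe_add,
        ← DirectSum.add_apply, ← DirectSum.decompose_add, hiy, DirectSum.decompose_of_mem_same 𝒜 ha]
    refine ⟨DirectSum.decompose 𝒜 u t, SetLike.coe_mem _, ?_⟩
    rw [hcomponent, map_add, mkₐ_toLinearMap_eq_zero_iff.2 (hI _ hi), zero_add]
    rfl

theorem hilbertFunction_add {I : Ideal A} (hI : I.IsHomogeneous 𝒜) {f : A} {e : ℕ}
    (hf : f ∈ 𝒜 e) (t : ℕ) [Module.Finite K (𝒜 (e + t))] :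
    hilbertFunction 𝒜 I (e + t) =
      hilbertFunction 𝒜 (I.colon {f}) t + hilbertFunction 𝒜 (I ⊔ Ideal.span {f}) (e + t) := by
  have hcolon := hilbertFunction_eq_finrank_map (𝒜 := 𝒜) (I := I.colon {f}) (t := t)
    ((Ideal.Quotient.mkₐ K I).toLinearMap ∘ₗ LinearMap.mulLeft K f) fun a _ => by
      rw [LinearMap.comp_apply, mkₐ_toLinearMap_eq_zero_iff, Submodule.mem_colon_singleton,
        LinearMap.mulLeft_apply, smul_eq_mul, mul_comm]
  have hsum := finrank_map_add_finrank_inf_ker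
    ((𝒜 (e + t)).map (Ideal.Quotient.mkₐ K I).toLinearMap)
    (Ideal.Quotient.factorₐ K (le_sup_left : I ≤ I ⊔ Ideal.span {f})).toLinearMap
  rw [← Submodule.map_comp, ← AlgHom.comp_toLinearMap, Ideal.Quotient.factorₐ_comp_mk,
    ← map_mkₐ_mulLeft hI hf t, ← hcolon, add_comm] at hsum
  exact hsum.symm

end HilbertFunction

section HilbertPolynomial

open Polynomial (taylor)

variable {K A : Type*} [Field K] [CommRing A] [Algebra K A] {𝒜 : ℕ → Submodule K A}
  {I J : Ideal A} {P Q : Polynomial ℚ} {f : A} {e : ℕ}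

/-- `P` is a Hilbert polynomial of `A ⧸ I`: it agrees with the Hilbert function at all large
integers. -/
def IsHilbertPolynomial (𝒜 : ℕ → Submodule K A) (I : Ideal A) (P : Polynomial ℚ) : Prop :=
  ∀ᶠ t : ℕ in atTop, (hilbertFunction 𝒜 I t : ℚ) = P.eval (t : ℚ)

namespace IsHilbertPolynomial

theorem unique (hP : IsHilbertPolynomial 𝒜 I P) (hQ : IsHilbertPolynomial 𝒜 I Q) : P = Q := by
  refine eq_of_eventually_eval_eq ?_
  filter_upwards [hP, hQ] with t hPt hQt
  exact hPt.symm.trans hQt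

theorem degree_le [∀ t, Module.Finite K (𝒜 t)] (hIJ : I ≤ J) (hP : IsHilbertPolynomial 𝒜 I P)
    (hQ : IsHilbertPolynomial 𝒜 J Q) : Q.degree ≤ P.degree := by
  apply degree_le_of_eventually_eval_le
  · filter_upwards [hQ] with t hQt
    exact hQt ▸ Nat.cast_nonneg _
  · filter_upwards [hP, hQ] with t hPt hQt
    rw [← hPt, ← hQt]
    exact_mod_cast hilbertFunction_anti hIJ t

theorem ne_zero [GradedAlgebra 𝒜] [∀ t, Module.Finite K (𝒜 t)] [hI : I.IsPrime] (hf : f ∈ 𝒜 1)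
    (hfI : f ∉ I) (hP : IsHilbertPolynomial 𝒜 I P) : P ≠ 0 := by
  rintro rfl
  obtain ⟨t, ht⟩ := hP.exists
  have hpow : f ^ t ∈ 𝒜 t := by simpa using SetLike.pow_mem_graded t hf
  have hpos := hilbertFunction_pos hpow fun h => hfI (hI.mem_of_pow_mem t h)
  simp [hpos.ne'] at ht

theorem of_colon_of_sup [GradedAlgebra 𝒜] [∀ t, Module.Finite K (𝒜 t)] (hI : I.IsHomogeneous 𝒜)
    (hf : f ∈ 𝒜 e) (hP : IsHilbertPolynomial 𝒜 (I.colon {f}) P)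
    (hQ : IsHilbertPolynomial 𝒜 (I ⊔ Ideal.span {f}) Q) :
    IsHilbertPolynomial 𝒜 I (taylor (-e : ℚ) P + Q) := by
  filter_upwards [(tendsto_sub_atTop_nat e).eventually hP, hQ, eventually_ge_atTop e]
    with t hPt hQt het
  obtain ⟨s, rfl⟩ := Nat.exists_eq_add_of_le het
  rw [add_tsub_cancel_left] at hPt
  rw [hilbertFunction_add hI hf, Nat.cast_add, hPt, hQt, Polynomial.eval_add,
    Polynomial.taylor_eval, Nat.cast_add, add_neg_cancel_comm]

theorem sup_of_isPrime [GradedAlgebra 𝒜] [∀ t, Module.Finite K (𝒜 t)] [I.IsPrime]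
    (hI : I.IsHomogeneous 𝒜) (hf : f ∈ 𝒜 e) (hfI : f ∉ I) (hP : IsHilbertPolynomial 𝒜 I P) :
    IsHilbertPolynomial 𝒜 (I ⊔ Ideal.span {f}) (P - taylor (-e : ℚ) P) := by
  filter_upwards [(tendsto_sub_atTop_nat e).eventually hP, hP, eventually_ge_atTop e]
    with t hPt' hPt het
  obtain ⟨s, rfl⟩ := Nat.exists_eq_add_of_le het
  rw [add_tsub_cancel_left] at hPt'
  rw [hilbertFunction_add hI hf, colon_singleton_eq_self_of_isPrime hfI, Nat.cast_add] at hPt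
  rw [Polynomial.eval_sub, Polynomial.taylor_eval, ← hPt, Nat.cast_add, add_neg_cancel_comm,
    ← hPt', add_sub_cancel_left]

theorem degree_lt [GradedAlgebra 𝒜] [∀ t, Module.Finite K (𝒜 t)] [I.IsPrime]
    (hI : I.IsHomogeneous 𝒜) (hJ : J.IsHomogeneous 𝒜) (hIJ : I < J) (hP0 : P ≠ 0)
    (hP : IsHilbertPolynomial 𝒜 I P) (hQ : IsHilbertPolynomial 𝒜 J Q) : Q.degree < P.degree := by
  obtain ⟨e, f, hf, hfJ, hfI⟩ := exists_homogeneous_notMem_of_lt hJ hIJ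
  have hsup : I ⊔ Ideal.span {f} ≤ J :=
    sup_le hIJ.le ((Ideal.span_singleton_le_iff_mem J).2 hfJ)
  exact ((hP.sup_of_isPrime hI hf hfI).degree_le hsup hQ).trans_lt (degree_sub_taylor_lt hP0 _)

end IsHilbertPolynomial

variable [GradedAlgebra 𝒜]

theorem isHilbertPolynomial_zero
    (h𝒜 : (HomogeneousIdeal.irrelevant 𝒜).toIdeal ≤ Ideal.span (𝒜 1))
    (hI : ∀ a ∈ 𝒜 1, a ∈ I) : IsHilbertPolynomial 𝒜 I 0 := by
  filter_upwards [eventually_gt_atTop 0] with t ht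
  rw [Polynomial.eval_zero, Nat.cast_eq_zero]
  exact hilbertFunction_eq_zero fun a ha =>
    (h𝒜.trans (Ideal.span_le.2 hI)) (HomogeneousIdeal.mem_irrelevant_of_mem 𝒜 ht ha)

variable [IsNoetherianRing A] [∀ t, Module.Finite K (𝒜 t)]

theorem exists_isHilbertPolynomial
    (h𝒜 : (HomogeneousIdeal.irrelevant 𝒜).toIdeal ≤ Ideal.span (𝒜 1)) (hI : I.IsHomogeneous 𝒜) :
    ∃ P, IsHilbertPolynomial 𝒜 I P := by
  induction hI using isHomogeneous_induction with
  | top => exact ⟨0, isHilbertPolynomial_zero h𝒜 fun _ _ => Submodule.mem_top⟩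
  | prime I hI hprime ih =>
    by_cases hI1 : ∀ a ∈ 𝒜 1, a ∈ I
    · exact ⟨0, isHilbertPolynomial_zero h𝒜 hI1⟩
    push Not at hI1
    obtain ⟨f, hf, hfI⟩ := hI1
    obtain ⟨Q, hQ⟩ := ih _ (hI.sup (isHomogeneous_span_singleton hf)) (lt_sup_span_singleton hfI)
    refine exists_polynomial_of_eventually_sub_eq (P := taylor 1 Q) ?_
    filter_upwards [(tendsto_add_atTop_nat 1).eventually hQ] with t hQt
    rw [Polynomial.taylor_eval, ← Nat.cast_add_one, ← hQt, add_comm t, hilbertFunction_add hI hf,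
      colon_singleton_eq_self_of_isPrime hfI, Nat.cast_add, add_sub_cancel_left]
  | step I hI e f hf ihcolon ihsup =>
    obtain ⟨P, hP⟩ := ihcolon
    obtain ⟨Q, hQ⟩ := ihsup
    exact ⟨_, hP.of_colon_of_sup hI hf hQ⟩

theorem exists_isPrime_degree_le
    (h𝒜 : (HomogeneousIdeal.irrelevant 𝒜).toIdeal ≤ Ideal.span (𝒜 1)) (hI : I.IsHomogeneous 𝒜)
    (hP : IsHilbertPolynomial 𝒜 I P) (hP0 : P ≠ 0) :
    ∃ J : Ideal A, I ≤ J ∧ J.IsPrime ∧ J.IsHomogeneous 𝒜 ∧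
      ∃ Q, IsHilbertPolynomial 𝒜 J Q ∧ P.degree ≤ Q.degree := by
  induction hI using isHomogeneous_induction generalizing P with
  | top =>
    exact absurd (hP.unique (isHilbertPolynomial_zero h𝒜 fun _ _ => Submodule.mem_top)) hP0
  | prime I hI hprime _ => exact ⟨I, le_rfl, hprime, hI, P, hP, le_rfl⟩
  | step I hI e f hf ihcolon ihsup =>
    obtain ⟨P₁, hP₁⟩ := exists_isHilbertPolynomial h𝒜 (isHomogeneous_colon_singleton hI hf)
    obtain ⟨P₂, hP₂⟩ :=
      exists_isHilbertPolynomial h𝒜 (hI.sup (isHomogeneous_span_singleton hf))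
    have hmax : P.degree ≤ max P₁.degree P₂.degree := by
      rw [hP.unique (hP₁.of_colon_of_sup hI hf hP₂), ← Polynomial.degree_taylor P₁ (-e : ℚ)]
      exact Polynomial.degree_add_le _ _
    have hbot : ⊥ < P.degree := bot_lt_iff_ne_bot.2 (Polynomial.degree_ne_bot.2 hP0)
    rcases le_max_iff.1 hmax with hle | hle
    · obtain ⟨J, hJ, hprime, hJhom, Q, hQ, hQle⟩ :=
        ihcolon hP₁ (Polynomial.ne_zero_of_degree_gt (hbot.trans_le hle))
      exact ⟨J, Ideal.le_colon.trans hJ, hprime, hJhom, Q, hQ, hle.trans hQle⟩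
    · obtain ⟨J, hJ, hprime, hJhom, Q, hQ, hQle⟩ :=
        ihsup hP₂ (Polynomial.ne_zero_of_degree_gt (hbot.trans_le hle))
      exact ⟨J, le_sup_left.trans hJ, hprime, hJhom, Q, hQ, hle.trans hQle⟩

theorem exists_isPrime_degree_eq [I.IsPrime]
    (h𝒜 : (HomogeneousIdeal.irrelevant 𝒜).toIdeal ≤ Ideal.span (𝒜 1)) (hI : I.IsHomogeneous 𝒜)
    (hf : f ∈ 𝒜 1) (hfI : f ∉ I) (hP : IsHilbertPolynomial 𝒜 I P) {d : ℕ}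
    (hd : P.natDegree = d + 1) :
    ∃ J : Ideal A, I < J ∧ J.IsPrime ∧ J.IsHomogeneous 𝒜 ∧
      ∃ Q, IsHilbertPolynomial 𝒜 J Q ∧ Q.degree = d := by
  have hsup := hP.sup_of_isPrime hI hf hfI
  have hP0 : P ≠ 0 := hP.ne_zero hf hfI
  have hcoeff : (P - taylor (-(1 : ℕ) : ℚ) P).coeff d ≠ 0 := by
    rw [coeff_sub_taylor hd, Nat.cast_one, mul_neg_one, neg_neg]
    exact mul_ne_zero d.cast_add_one_ne_zero (Polynomial.leadingCoeff_ne_zero.2 hP0)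
  obtain ⟨J, hJ, hprime, hJhom, Q, hQ, hle⟩ := exists_isPrime_degree_le h𝒜
    (hI.sup (isHomogeneous_span_singleton hf)) hsup fun h =>
      hcoeff (by rw [h, Polynomial.coeff_zero])
  have hIJ : I < J := (lt_sup_span_singleton hfI).trans_le hJ
  refine ⟨J, hIJ, hprime, hJhom, Q, hQ,
    le_antisymm ?_ ((Polynomial.le_degree_of_ne_zero hcoeff).trans hle)⟩
  have hlt := hP.degree_lt hI hJhom hIJ hP0 hQ
  rw [Polynomial.degree_eq_natDegree hP0, hd] at hlt
  exact Order.le_of_lt_succ hlt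

end HilbertPolynomial

section Topology

open TopologicalSpace Topology

theorem isIrreducible_preimage_of_isInducing {S T : Type*} [TopologicalSpace S]
    [TopologicalSpace T] {f : S → T} (hf : IsInducing f) {Z : Set T} (hZ : IsIrreducible Z)
    (hZf : Z ⊆ Set.range f) : IsIrreducible (f ⁻¹' Z) := by
  refine ⟨hZ.nonempty.preimage' hZf, ?_⟩
  intro u' v' hu' hv' ⟨a, haZ, hau⟩ ⟨b, hbZ, hbv⟩
  obtain ⟨u, hu, rfl⟩ := hf.isOpen_iff.1 hu'
  obtain ⟨v, hv, rfl⟩ := hf.isOpen_iff.1 hv'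
  obtain ⟨y, hyZ, hyuv⟩ := hZ.2 u v hu hv ⟨f a, haZ, hau⟩ ⟨f b, hbZ, hbv⟩
  obtain ⟨x, rfl⟩ := hZf hyZ
  exact ⟨x, hyZ, hyuv⟩

theorem topologicalKrullDim_coe_eq_height {T : Type*} [TopologicalSpace T]
    (Z : IrreducibleCloseds T) : topologicalKrullDim (Z : Set T) = Order.height Z := by
  rw [Order.height_eq_krullDim_Iic, topologicalKrullDim]
  have hval : IsInducing (Subtype.val : ↥(Z : Set T) → T) := IsInducing.subtypeVal
  have hrange (W : Set.Iic Z) : (W.1 : Set T) ⊆ Set.range (Subtype.val : ↥(Z : Set T) → T) :=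
    Subtype.range_val ▸ W.2
  apply le_antisymm
  · refine Order.krullDim_le_of_strictMono
      (fun W => ⟨IrreducibleCloseds.map Subtype.val hval.continuous W, ?_⟩)
      fun _ _ hlt => IrreducibleCloseds.map_strictMono_of_isInducing hval hlt
    exact closure_minimal (Subtype.coe_image_subset _ _) Z.isClosed
  · refine Order.krullDim_le_of_strictMono (fun W => ⟨Subtype.val ⁻¹' (W.1 : Set T),
      isIrreducible_preimage_of_isInducing hval W.1.isIrreducible (hrange W),
      W.1.isClosed.preimage hval.continuous⟩) fun V W hVW => ?_
    exact lt_of_le_not_ge (fun x hx => hVW.le hx) fun hWV =>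
      hVW.not_ge ((Set.preimage_subset_preimage_iff (hrange W)).1 hWV)

theorem isIrreducible_range_uncurry {S T Z : Type*} [TopologicalSpace S] [TopologicalSpace T]
    [TopologicalSpace Z] [IrreducibleSpace S] [IrreducibleSpace T] {f : S → T → Z}
    (hS : ∀ t, Continuous fun s => f s t) (hT : ∀ s, Continuous (f s)) :
    IsIrreducible (Set.range fun p : S × T => f p.1 p.2) := by
  refine ⟨Set.range_nonempty _, ?_⟩
  rintro U V hU hV ⟨_, ⟨⟨s, t⟩, rfl⟩, hst⟩ ⟨_, ⟨⟨s', t'⟩, rfl⟩, hst'⟩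
  obtain ⟨s₀, hs₀U, hs₀V⟩ := nonempty_preirreducible_inter (hU.preimage (hS t))
    (hV.preimage (hS t')) ⟨s, hst⟩ ⟨s', hst'⟩
  obtain ⟨t₀, ht₀U, ht₀V⟩ := nonempty_preirreducible_inter (hU.preimage (hT s₀))
    (hV.preimage (hT s₀)) ⟨t, hs₀U⟩ ⟨t', hs₀V⟩
  exact ⟨_, ⟨(s₀, t₀), rfl⟩, ht₀U, ht₀V⟩

end Topology

section ProjectiveSpace

variable {K : Type*} [Field K] {n : ℕ}

theorem eval_smul_of_isHomogeneous {R σ : Type*} [CommSemiring R] {f : MvPolynomial σ R} {d : ℕ}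
    (hf : f.IsHomogeneous d) (c : R) (x : σ → R) : eval (c • x) f = c ^ d * eval x f := by
  rw [eval_eq, eval_eq, Finset.mul_sum]
  refine Finset.sum_congr rfl fun m hm => ?_
  have hdegree : m.degree = d := by
    by_contra hne
    exact mem_support_iff.1 hm (hf.coeff_eq_zero hne)
  simp only [Pi.smul_apply, smul_eq_mul, mul_pow, Finset.prod_mul_distrib]
  rw [Finset.prod_pow_eq_pow_sum, ← hdegree, Finsupp.degree_apply]
  ring

theorem eval_mk_rep_eq_zero_iff {f : MvPolynomial (Fin (n + 1)) K} (hf : IsForm f)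
    {v : Fin (n + 1) → K} (hv : v ≠ 0) :
    eval (Projectivization.mk K v hv).rep f = 0 ↔ eval v f = 0 := by
  obtain ⟨d, hf⟩ := hf
  obtain ⟨a, ha⟩ := Projectivization.exists_smul_eq_mk_rep K v hv
  rw [← ha, Units.smul_def, eval_smul_of_isHomogeneous hf,
    mul_eq_zero_iff_left (pow_ne_zero d a.ne_zero)]

theorem IsForm.mul {f g : MvPolynomial (Fin (n + 1)) K} (hf : IsForm f) (hg : IsForm g) :
    IsForm (f * g) := by
  obtain ⟨d, hf⟩ := hf
  obtain ⟨e, hg⟩ := hg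
  exact ⟨d + e, hf.mul hg⟩

theorem isClosed_iff {Z : Set (PSpace K n)} :
    IsClosed Z ↔ ∃ T : Set (MvPolynomial (Fin (n + 1)) K), (∀ f ∈ T, IsForm f) ∧ Z = zeros T := by
  rw [← isOpen_compl_iff]
  change Zᶜᶜ ∈ _ ↔ _
  rw [compl_compl]
  rfl

theorem isClosed_zeros {T : Set (MvPolynomial (Fin (n + 1)) K)} (hT : ∀ f ∈ T, IsForm f) :
    IsClosed (zeros T) :=
  isClosed_iff.2 ⟨T, hT, rfl⟩

theorem isClosed_zeros_singleton {f : MvPolynomial (Fin (n + 1)) K} (hf : IsForm f) :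
    IsClosed (zeros {f}) :=
  isClosed_zeros fun _ hg => hg ▸ hf

theorem mem_zeros_singleton {f : MvPolynomial (Fin (n + 1)) K} {p : PSpace K n} :
    p ∈ zeros {f} ↔ eval p.rep f = 0 := by
  simp only [zeros, Set.mem_singleton_iff, forall_eq, Set.mem_ofPred_eq]

theorem eval_rep_eq_zero_of_mem_homogeneousIdeal {X : Set (PSpace K n)}
    {f : MvPolynomial (Fin (n + 1)) K} (hf : f ∈ homogeneousIdeal X) {p : PSpace K n}
    (hp : p ∈ X) : eval p.rep f = 0 := by
  have hker : homogeneousIdeal X ≤ RingHom.ker (eval p.rep) :=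
    Ideal.span_le.2 fun g hg => hg.2 p hp
  exact hker hf

theorem mem_homogeneousIdeal_iff {X : Set (PSpace K n)} {f : MvPolynomial (Fin (n + 1)) K}
    (hf : IsForm f) : f ∈ homogeneousIdeal X ↔ ∀ p ∈ X, eval p.rep f = 0 :=
  ⟨fun h _ hp => eval_rep_eq_zero_of_mem_homogeneousIdeal h hp,
    fun h => Ideal.subset_span ⟨hf, h⟩⟩

theorem subset_zeros_iff {X : Set (PSpace K n)} {T : Set (MvPolynomial (Fin (n + 1)) K)}
    (hT : ∀ f ∈ T, IsForm f) : X ⊆ zeros T ↔ T ⊆ homogeneousIdeal X :=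
  ⟨fun h f hf => (mem_homogeneousIdeal_iff (hT f hf)).2 fun _ hp => h hp f hf,
    fun h _ hp _ hf => eval_rep_eq_zero_of_mem_homogeneousIdeal (h hf) hp⟩

theorem subset_zeros_singleton_iff {X : Set (PSpace K n)} {f : MvPolynomial (Fin (n + 1)) K}
    (hf : IsForm f) : X ⊆ zeros {f} ↔ f ∈ homogeneousIdeal X := by
  rw [subset_zeros_iff fun _ hg => hg ▸ hf, Set.singleton_subset_iff, SetLike.mem_coe]

theorem homogeneousIdeal_anti {X Y : Set (PSpace K n)} (h : X ⊆ Y) :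
    homogeneousIdeal Y ≤ homogeneousIdeal X :=
  Ideal.span_mono fun _ hf => ⟨hf.1, fun p hp => hf.2 p (h hp)⟩

theorem subset_of_homogeneousIdeal_le {X Y : Set (PSpace K n)} (hY : IsClosed Y)
    (h : homogeneousIdeal Y ≤ homogeneousIdeal X) : X ⊆ Y := by
  obtain ⟨T, hT, rfl⟩ := isClosed_iff.1 hY
  exact (subset_zeros_iff hT).2 (((subset_zeros_iff hT).1 subset_rfl).trans h)

theorem homogeneousIdeal_closure (X : Set (PSpace K n)) :
    homogeneousIdeal (closure X) = homogeneousIdeal X := by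
  refine le_antisymm (homogeneousIdeal_anti subset_closure) (Ideal.span_le.2 ?_)
  rintro f ⟨hf, hfX⟩
  rw [SetLike.mem_coe, ← subset_zeros_singleton_iff hf,
    (isClosed_zeros_singleton hf).closure_subset_iff, subset_zeros_singleton_iff hf]
  exact Ideal.subset_span ⟨hf, hfX⟩

theorem exists_X_notMem_homogeneousIdeal {X : Set (PSpace K n)} (hX : X.Nonempty) :
    ∃ i, (MvPolynomial.X i : MvPolynomial (Fin (n + 1)) K) ∉ homogeneousIdeal X := by
  obtain ⟨p, hp⟩ := hX
  obtain ⟨i, hi⟩ := Function.ne_iff.1 p.rep_nonzero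
  refine ⟨i, fun h => hi ?_⟩
  simpa using eval_rep_eq_zero_of_mem_homogeneousIdeal h hp

attribute [local instance] MvPolynomial.gradedAlgebra

theorem isHomogeneous_homogeneousIdeal (X : Set (PSpace K n)) :
    (homogeneousIdeal X).IsHomogeneous (homogeneousSubmodule (Fin (n + 1)) K) :=
  Ideal.homogeneous_span _ _ fun _ hf => hf.1

theorem isPrime_homogeneousIdeal_iff {X : Set (PSpace K n)} :
    (homogeneousIdeal X).IsPrime ↔ IsIrreducible X := by
  constructor
  · intro hprime
    refine ⟨Set.nonempty_iff_ne_empty.2 ?_,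
      isPreirreducible_iff_isClosed_union_isClosed.2 fun Z₁ Z₂ hZ₁ hZ₂ hXZ => ?_⟩
    · rintro rfl
      refine hprime.one_notMem ((mem_homogeneousIdeal_iff ⟨0, isHomogeneous_one _ _⟩).2 ?_)
      exact fun p hp => hp.elim
    obtain ⟨T₁, hT₁, rfl⟩ := isClosed_iff.1 hZ₁
    obtain ⟨T₂, hT₂, rfl⟩ := isClosed_iff.1 hZ₂
    rw [subset_zeros_iff hT₁, subset_zeros_iff hT₂]
    by_contra! hcon
    obtain ⟨⟨f, hf, hfX⟩, g, hg, hgX⟩ := hcon.imp Set.not_subset.1 Set.not_subset.1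
    refine (hprime.mul_notMem hfX hgX)
      ((mem_homogeneousIdeal_iff ((hT₁ f hf).mul (hT₂ g hg))).2 fun p hp => ?_)
    rw [map_mul, mul_eq_zero]
    exact (hXZ hp).imp (· f hf) (· g hg)
  · intro hX
    refine (isHomogeneous_homogeneousIdeal X).isPrime_of_homogeneous_mem_or_mem ?_ ?_
    · intro htop
      obtain ⟨i, hi⟩ := exists_X_notMem_homogeneousIdeal hX.nonempty
      exact hi (htop ▸ Submodule.mem_top)
    · intro f g hf hg hfg
      have hcover : X ⊆ zeros {f} ∪ zeros {g} := fun p hp => by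
        rw [Set.mem_union, mem_zeros_singleton, mem_zeros_singleton, ← mul_eq_zero, ← map_mul]
        exact eval_rep_eq_zero_of_mem_homogeneousIdeal hfg hp
      rw [← subset_zeros_singleton_iff hf, ← subset_zeros_singleton_iff hg]
      exact isPreirreducible_iff_isClosed_union_isClosed.1 hX.isPreirreducible _ _
        (isClosed_zeros_singleton hf) (isClosed_zeros_singleton hg) hcover

/-- The zero set in projective space of a homogeneous ideal: the common zeros of its forms. -/
def projZeroLocus (I : Ideal (MvPolynomial (Fin (n + 1)) K)) : Set (PSpace K n) :=
  zeros {f | f ∈ I ∧ IsForm f}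

theorem isClosed_projZeroLocus (I : Ideal (MvPolynomial (Fin (n + 1)) K)) :
    IsClosed (projZeroLocus I) :=
  isClosed_zeros fun _ hf => hf.2

theorem mk_mem_projZeroLocus {I : Ideal (MvPolynomial (Fin (n + 1)) K)} {v : Fin (n + 1) → K}
    (hvI : v ∈ zeroLocus K I) (hv : v ≠ 0) : Projectivization.mk K v hv ∈ projZeroLocus I :=
  fun f hf => (eval_mk_rep_eq_zero_iff hf.2 hv).2 (hvI f hf.1)

theorem le_homogeneousIdeal_projZeroLocus {I : Ideal (MvPolynomial (Fin (n + 1)) K)}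
    (hI : I.IsHomogeneous (homogeneousSubmodule (Fin (n + 1)) K)) :
    I ≤ homogeneousIdeal (projZeroLocus I) := by
  intro f hf
  rw [← sum_homogeneousComponent f]
  refine sum_mem fun d _ => ?_
  have hform : IsForm (homogeneousComponent d f) := ⟨d, homogeneousComponent_isHomogeneous d f⟩
  exact (mem_homogeneousIdeal_iff hform).2 fun p hp =>
    hp _ ⟨homogeneousComponent_mem_of_mem hI hf d, hform⟩

theorem homogeneousIdeal_projZeroLocus [IsAlgClosed K] {I : Ideal (MvPolynomial (Fin (n + 1)) K)}
    (hI : I.IsRadical) (hIh : I.IsHomogeneous (homogeneousSubmodule (Fin (n + 1)) K))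
    (hX : ∃ i, MvPolynomial.X i ∉ I) : homogeneousIdeal (projZeroLocus I) = I := by
  have hnull : ∀ f, (∀ v ∈ zeroLocus K I, eval v f = 0) → f ∈ I := fun f hf => by
    rw [← hI.radical, ← vanishingIdeal_zeroLocus_eq_radical (K := K) I]
    exact hf
  obtain ⟨p, hp⟩ : (projZeroLocus I).Nonempty := by
    obtain ⟨i, hi⟩ := hX
    contrapose! hi
    refine hnull _ fun v hv => ?_
    by_contra hvi
    have hv0 : v ≠ 0 := by
      rintro rfl
      simp at hvi
    exact Set.eq_empty_iff_forall_notMem.1 hi _ (mk_mem_projZeroLocus hv hv0)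
  refine le_antisymm (Ideal.span_le.2 ?_) (le_homogeneousIdeal_projZeroLocus hIh)
  rintro f ⟨hf, hfI⟩
  refine hnull f fun v hv => ?_
  rcases eq_or_ne v 0 with rfl | hv0
  · obtain ⟨d, hf⟩ := hf
    rw [← zero_smul K p.rep, eval_smul_of_isHomogeneous hf, hfI p hp, mul_zero]
  · exact (eval_mk_rep_eq_zero_iff hf hv0).1 (hfI _ (mk_mem_projZeroLocus hv hv0))

end ProjectiveSpace

section Dimension

open TopologicalSpace

attribute [local instance] MvPolynomial.gradedAlgebra

theorem finite_homogeneousSubmodule {R σ : Type*} [CommSemiring R] [Finite σ] (t : ℕ) :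
    Module.Finite R (homogeneousSubmodule σ R t) :=
  Module.Finite.iff_fg.2 (homogeneousSubmodule_fg _ _ t)

attribute [local instance] finite_homogeneousSubmodule

theorem irrelevant_le_span_homogeneousSubmodule_one {R σ : Type*} [CommRing R] :
    (HomogeneousIdeal.irrelevant (homogeneousSubmodule σ R)).toIdeal ≤
      Ideal.span (homogeneousSubmodule σ R 1 : Set (MvPolynomial σ R)) := by
  refine (HomogeneousIdeal.toIdeal_irrelevant_le _).2 fun t ht f hf => ?_
  obtain ⟨s, rfl⟩ := Nat.exists_eq_add_of_lt ht
  have hpow : f ∈ homogeneousSubmodule σ R 1 ^ s * homogeneousSubmodule σ R 1 := by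
    rw [← pow_succ, homogeneousSubmodule_one_pow, ← zero_add s]
    exact hf
  refine Submodule.mul_induction_on hpow (fun g _ h hh => ?_) fun _ _ => add_mem
  exact Ideal.mul_mem_left _ g (Ideal.subset_span hh)

theorem homogeneousSubmodule_one_subset_of_forall_X_mem {R σ : Type*} [CommSemiring R]
    {I : Ideal (MvPolynomial σ R)} (hI : ∀ i, MvPolynomial.X i ∈ I) :
    (homogeneousSubmodule σ R 1 : Set (MvPolynomial σ R)) ⊆ I := by
  have hle : homogeneousSubmodule σ R 1 ≤ I.restrictScalars R := by
    rw [homogeneousSubmodule_one_eq_span_X, Submodule.span_le]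
    exact Set.range_subset_iff.2 hI
  exact hle

variable {K : Type*} [Field K] {n : ℕ} {X : Set (PSpace K n)}

theorem isHilbertPolynomial_hilbertPolynomial (X : Set (PSpace K n)) :
    IsHilbertPolynomial (homogeneousSubmodule (Fin (n + 1)) K) (homogeneousIdeal X)
      (hilbertPolynomial X) :=
  Classical.epsilon_spec (p := fun P : Polynomial ℚ =>
    ∀ᶠ t : ℕ in atTop, (HF X t : ℚ) = P.eval (t : ℚ))
    (exists_isHilbertPolynomial irrelevant_le_span_homogeneousSubmodule_one
      (isHomogeneous_homogeneousIdeal X))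

theorem hilbertPolynomial_ne_zero (hX : IsIrreducible X) : hilbertPolynomial X ≠ 0 := by
  have hprime := isPrime_homogeneousIdeal_iff.2 hX
  obtain ⟨i, hi⟩ := exists_X_notMem_homogeneousIdeal hX.nonempty
  exact (isHilbertPolynomial_hilbertPolynomial X).ne_zero (isHomogeneous_X K i) hi

theorem natDegree_hilbertPolynomial_strictMono :
    StrictMono fun Z : IrreducibleCloseds (PSpace K n) =>
      (hilbertPolynomial (Z : Set (PSpace K n))).natDegree := by
  intro Z W hZW
  have hprime := isPrime_homogeneousIdeal_iff.2 W.isIrreducible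
  have hlt : homogeneousIdeal (W : Set (PSpace K n)) < homogeneousIdeal (Z : Set (PSpace K n)) :=
    lt_of_le_not_ge (homogeneousIdeal_anti hZW.le) fun h =>
      hZW.not_ge (subset_of_homogeneousIdeal_le Z.isClosed h)
  have hdegree := (isHilbertPolynomial_hilbertPolynomial (W : Set (PSpace K n))).degree_lt
    (isHomogeneous_homogeneousIdeal (W : Set (PSpace K n)))
    (isHomogeneous_homogeneousIdeal (Z : Set (PSpace K n))) hlt
    (hilbertPolynomial_ne_zero W.isIrreducible)
    (isHilbertPolynomial_hilbertPolynomial (Z : Set (PSpace K n)))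
  exact Polynomial.natDegree_lt_natDegree (hilbertPolynomial_ne_zero Z.isIrreducible) hdegree

theorem exists_irreducibleCloseds_lt_natDegree_eq [IsAlgClosed K]
    (Z : IrreducibleCloseds (PSpace K n)) {d : ℕ}
    (hd : (hilbertPolynomial (Z : Set (PSpace K n))).natDegree = d + 1) :
    ∃ W < Z, (hilbertPolynomial (W : Set (PSpace K n))).natDegree = d := by
  have hprime := isPrime_homogeneousIdeal_iff.2 Z.isIrreducible
  obtain ⟨i, hi⟩ := exists_X_notMem_homogeneousIdeal Z.isIrreducible.nonempty
  obtain ⟨J, hZJ, hJ, hJh, Q, hQ, hQd⟩ := exists_isPrime_degree_eq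
    (𝒜 := homogeneousSubmodule (Fin (n + 1)) K) irrelevant_le_span_homogeneousSubmodule_one
    (isHomogeneous_homogeneousIdeal (Z : Set (PSpace K n))) (isHomogeneous_X K i) hi
    (isHilbertPolynomial_hilbertPolynomial (Z : Set (PSpace K n))) hd
  have hX : ∃ i, MvPolynomial.X i ∉ J := by
    by_contra! hall
    have hzero : IsHilbertPolynomial (homogeneousSubmodule (Fin (n + 1)) K) J 0 := by
      exact isHilbertPolynomial_zero irrelevant_le_span_homogeneousSubmodule_one
        (homogeneousSubmodule_one_subset_of_forall_X_mem hall)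
    simp [hQ.unique hzero] at hQd
  have hJW := homogeneousIdeal_projZeroLocus hJ.isRadical hJh hX
  let W : IrreducibleCloseds (PSpace K n) :=
    ⟨projZeroLocus J, isPrime_homogeneousIdeal_iff.1 (hJW.symm ▸ hJ), isClosed_projZeroLocus J⟩
  have hWZ : W < Z := lt_of_le_not_ge (subset_of_homogeneousIdeal_le Z.isClosed (hJW ▸ hZJ.le))
    fun hle => hZJ.not_ge (hJW ▸ homogeneousIdeal_anti hle)
  have hWQ : hilbertPolynomial (projZeroLocus J) = Q :=
    (isHilbertPolynomial_hilbertPolynomial (projZeroLocus J)).unique (hJW.symm ▸ hQ)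
  exact ⟨W, hWZ, hWQ ▸ Polynomial.natDegree_eq_of_degree_eq_some hQd⟩

theorem height_eq_natDegree_hilbertPolynomial [IsAlgClosed K]
    (Z : IrreducibleCloseds (PSpace K n)) :
    Order.height Z = (hilbertPolynomial (Z : Set (PSpace K n))).natDegree := by
  apply le_antisymm
  · have hle := Order.height_le_height_apply_of_strictMono _
      (natDegree_hilbertPolynomial_strictMono (K := K) (n := n)) Z
    rwa [Order.height_nat] at hle
  · generalize hd : (hilbertPolynomial (Z : Set (PSpace K n))).natDegree = d
    induction d generalizing Z with
    | zero => exact zero_le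
    | succ d ih =>
      obtain ⟨W, hWZ, hWd⟩ := exists_irreducibleCloseds_lt_natDegree_eq Z hd
      calc ((d + 1 : ℕ) : ℕ∞) = d + 1 := Nat.cast_add_one d
        _ ≤ Order.height W + 1 := by gcongr; exact ih W hWd
        _ ≤ Order.height Z := Order.height_add_one_le hWZ

theorem dim_eq_natDegree_hilbertPolynomial [IsAlgClosed K] (hX : IsVariety X) :
    dim X = ((hilbertPolynomial X).natDegree : ℕ) := by
  let Z : IrreducibleCloseds (PSpace K n) := ⟨X, hX.2, hX.1⟩
  have hheight := topologicalKrullDim_coe_eq_height Z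
  rwa [height_eq_natDegree_hilbertPolynomial] at hheight

theorem degree_eq_factorial_mul_leadingCoeff [IsAlgClosed K] (hX : IsVariety X) :
    degree X = (hilbertPolynomial X).natDegree.factorial * (hilbertPolynomial X).leadingCoeff := by
  rw [degree, dim_eq_natDegree_hilbertPolynomial hX]
  rfl

end Dimension

section LinearDisjoint

variable {K A : Type*} [Field K] [CommRing A] [Algebra K A] {L L' : Submodule K A}

theorem finrank_mul_of_linearDisjoint (h : L.LinearDisjoint L') :
    Module.finrank K ↥(L * L') = Module.finrank K L * Module.finrank K L' := by
  rw [← h.mulMap.finrank_eq, Module.finrank_tensorProduct]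

theorem exists_linearMap_mul_eq_of_linearDisjoint {V : Type*} [AddCommGroup V] [Module K V]
    (h : L.LinearDisjoint L') (B : A →ₗ[K] A →ₗ[K] V) :
    ∃ φ : A →ₗ[K] V, ∀ p ∈ L, ∀ q ∈ L', φ (p * q) = B p q := by
  obtain ⟨φ, hφ⟩ := LinearMap.exists_extend
    (TensorProduct.lift (B.domRestrict₁₂ L L') ∘ₗ h.mulMap.symm.toLinearMap)
  refine ⟨φ, fun p hp q hq => ?_⟩
  have hpq := LinearMap.congr_fun hφ (h.mulMap ((⟨p, hp⟩ : L) ⊗ₜ[K] (⟨q, hq⟩ : L')))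
  simpa [LinearMap.domRestrict₁₂_apply] using hpq

theorem mul_ne_zero_of_linearDisjoint (h : L.LinearDisjoint L') {p q : A} (hp : p ∈ L)
    (hq : q ∈ L') (hp0 : p ≠ 0) (hq0 : q ≠ 0) : p * q ≠ 0 := by
  contrapose! hq0
  refine (Module.forall_dual_apply_eq_zero_iff K q).1 fun g => ?_
  obtain ⟨f, hf⟩ := not_forall.1 (mt (Module.forall_dual_apply_eq_zero_iff K p).1 hp0)
  obtain ⟨φ, hφ⟩ := exists_linearMap_mul_eq_of_linearDisjoint h
    ((LinearMap.mul K K).compl₁₂ f g)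
  have hfg : f p * g q = 0 := by
    rw [← map_zero φ, ← hq0, hφ p hp q hq]
    rfl
  exact (mul_eq_zero.1 hfg).resolve_left hf

end LinearDisjoint

section CoordinateFunctions

theorem map_aeval_homogeneousSubmodule {R σ A : Type*} [CommSemiring R] [CommSemiring A]
    [Algebra R A] (x : σ → A) (t : ℕ) :
    (homogeneousSubmodule σ R t).map (aeval x).toLinearMap =
      Submodule.span R (Set.range x) ^ t := by
  rw [← homogeneousSubmodule_one_pow, Submodule.map_pow, homogeneousSubmodule_one_eq_span_X,
    Submodule.map_span, ← Set.range_comp]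
  congr! 3
  exact funext (aeval_X x)

/-- Precomposition with a map, as a homomorphism between algebras of functions. -/
def precompAlgHom (R : Type*) [CommSemiring R] {S T : Type*} (f : S → T) :
    (T → R) →ₐ[R] (S → R) :=
  AlgHom.pi fun s => Pi.evalAlgHom R _ (f s)

variable {K : Type*} [Field K] {S T σ : Type*}

theorem finrank_map_precompAlgHom {f : S → T} (hf : f.Surjective) (V : Submodule K (T → K)) :
    Module.finrank K (V.map (precompAlgHom K f).toLinearMap) = Module.finrank K V :=
  (Submodule.equivMapOfInjective _ hf.injective_comp_right V).finrank_eq.symm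

theorem linearDisjoint_range_precompAlgHom_fst_snd :
    (LinearMap.range (precompAlgHom K (Prod.fst : S × T → S)).toLinearMap).LinearDisjoint
      (LinearMap.range (precompAlgHom K (Prod.snd : S × T → T)).toLinearMap) := by
  set M := LinearMap.range (precompAlgHom K (Prod.fst : S × T → S)).toLinearMap
  set N := LinearMap.range (precompAlgHom K (Prod.snd : S × T → T)).toLinearMap
  have hM (u : M) (s : S) (t t' : T) : u.1 (s, t) = u.1 (s, t') := by
    obtain ⟨_, g, rfl⟩ := u
    rfl
  have hN (w : N) (s s' : S) (t : T) : w.1 (s, t) = w.1 (s', t) := by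
    obtain ⟨_, g, rfl⟩ := w
    rfl
  let b := Module.Basis.ofVectorSpace K N
  refine Submodule.LinearDisjoint.of_basis_right _ _ b (LinearMap.ker_eq_bot'.2 fun m hm => ?_)
  ext i ⟨s, t⟩
  have hsum : ∑ i ∈ m.support, (m i).1 (s, t) • b i = 0 := by
    ext ⟨s', t'⟩
    have hm' := congrFun hm (s, t')
    simp only [Submodule.mulRightMap_apply, Finsupp.sum, Finset.sum_apply, Pi.mul_apply,
      Pi.zero_apply] at hm'
    simpa [hN _ s' s t', hM _ s t t'] using hm'
  by_cases hi : i ∈ m.support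
  · exact linearIndependent_iff'.1 b.linearIndependent _ _ hsum i hi
  · rw [Finsupp.notMem_support_iff.1 hi, Finsupp.coe_zero, Pi.zero_apply]

/-- The space spanned by the coordinate functions of a family of vectors. Its `t`-th power is the
space of restrictions of forms of degree `t` to the family. -/
def coordSpan (v : S → σ → K) : Submodule K (S → K) :=
  Submodule.span K (Set.range (Function.swap v))

theorem comp_mem_coordSpan [Finite σ] (v : S → σ → K) (φ : (σ → K) →ₗ[K] K) :
    φ ∘ v ∈ coordSpan v := by
  classical
  have := Fintype.ofFinite σ
  have hφ : φ ∘ v = ∑ i, φ (Pi.single i 1) • Function.swap v i := by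
    funext x
    rw [Function.comp_apply, pi_eq_sum_univ' (v x), map_sum]
    simp only [map_smul, Finset.sum_apply, Pi.smul_apply, smul_eq_mul, mul_comm, Function.swap]
  exact hφ ▸ sum_mem fun i _ => Submodule.smul_mem _ _ (Submodule.subset_span ⟨i, rfl⟩)

theorem coordSpan_mul [Finite σ] {L L' : Submodule K (σ → K)} (h : L.LinearDisjoint L')
    {u : S → σ → K} {w : T → σ → K} (hu : ∀ s, u s ∈ L) (hw : ∀ t, w t ∈ L') :
    coordSpan (fun x : S × T => u x.1 * w x.2) =
      (coordSpan u).map (precompAlgHom K Prod.fst).toLinearMap *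
        (coordSpan w).map (precompAlgHom K Prod.snd).toLinearMap := by
  rw [coordSpan, coordSpan, coordSpan, Submodule.map_span, Submodule.map_span,
    Submodule.span_mul_span]
  apply le_antisymm <;> rw [Submodule.span_le]
  · rintro _ ⟨i, rfl⟩
    exact Submodule.subset_span
      (Set.mul_mem_mul ⟨_, ⟨i, rfl⟩, rfl⟩ ⟨_, ⟨i, rfl⟩, rfl⟩)
  · rintro _ ⟨_, ⟨_, ⟨i, rfl⟩, rfl⟩, _, ⟨_, ⟨j, rfl⟩, rfl⟩, rfl⟩
    obtain ⟨φ, hφ⟩ := exists_linearMap_mul_eq_of_linearDisjoint h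
      ((LinearMap.mul K K).compl₁₂ (LinearMap.proj i) (LinearMap.proj j))
    have hcomp : φ ∘ (fun x : S × T => u x.1 * w x.2) =
        precompAlgHom K Prod.fst (Function.swap u i) *
          precompAlgHom K Prod.snd (Function.swap w j) :=
      funext fun x => hφ _ (hu x.1) _ (hw x.2)
    have hmem := comp_mem_coordSpan (fun x : S × T => u x.1 * w x.2) φ
    rw [hcomp] at hmem
    exact hmem

theorem finrank_coordSpan_mul_pow [Finite σ] [Nonempty S] [Nonempty T] {L L' : Submodule K (σ → K)}
    (h : L.LinearDisjoint L') {u : S → σ → K} {w : T → σ → K} (hu : ∀ s, u s ∈ L)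
    (hw : ∀ t, w t ∈ L') (d : ℕ) :
    Module.finrank K ↥(coordSpan (fun x : S × T => u x.1 * w x.2) ^ d) =
      Module.finrank K ↥(coordSpan u ^ d) * Module.finrank K ↥(coordSpan w ^ d) := by
  rw [coordSpan_mul h hu hw, mul_pow, ← Submodule.map_pow, ← Submodule.map_pow,
    finrank_mul_of_linearDisjoint, finrank_map_precompAlgHom, finrank_map_precompAlgHom]
  · exact Prod.snd_surjective
  · exact Prod.fst_surjective
  · exact linearDisjoint_range_precompAlgHom_fst_snd.of_le_of_flat_left LinearMap.map_le_range
      LinearMap.map_le_range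

end CoordinateFunctions

section Hadamard

variable {K : Type*} [Field K] {n : ℕ} {X Y : Set (PSpace K n)}

theorem HF_closure (X : Set (PSpace K n)) (t : ℕ) : HF (closure X) t = HF X t :=
  congrArg (hilbertFunction (homogeneousSubmodule (Fin (n + 1)) K) · t) (homogeneousIdeal_closure X)

theorem HF_range_mk {S : Type*} {v : S → Fin (n + 1) → K} (hv : ∀ s, v s ≠ 0) (t : ℕ) :
    HF (Set.range fun s => Projectivization.mk K (v s) (hv s)) t =
      Module.finrank K ↥(coordSpan v ^ t) := by
  rw [coordSpan, ← map_aeval_homogeneousSubmodule]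
  refine hilbertFunction_eq_finrank_map _ fun f hf => ?_
  have hform : IsForm f := ⟨t, hf⟩
  rw [mem_homogeneousIdeal_iff hform, Set.forall_mem_range, funext_iff]
  refine forall_congr' fun s => ?_
  have heval : aeval (Function.swap v) f s = eval (v s) f := by
    rw [← aeval_eq_eval]
    exact comp_aeval_apply (Function.swap v) (Pi.evalAlgHom K (fun _ => K) s) f
  rw [eval_mk_rep_eq_zero_iff hform, ← heval]
  rfl

theorem HF_eq_finrank_coordSpan_rep_pow (X : Set (PSpace K n)) (t : ℕ) :
    HF X t = Module.finrank K ↥(coordSpan (fun p : X => p.1.rep) ^ t) := by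
  rw [← HF_range_mk fun p : X => p.1.rep_nonzero]
  simp only [Projectivization.mk_rep, Subtype.range_coe]

theorem hadamard_eq_closure_range (hXY : ∀ p ∈ X, ∀ q ∈ Y, p.rep * q.rep ≠ 0) :
    hadamard X Y = closure (Set.range fun x : X × Y =>
      Projectivization.mk K (x.1.1.rep * x.2.1.rep) (hXY _ x.1.2 _ x.2.2)) := by
  refine congrArg closure (Set.ext fun z => ⟨?_, ?_⟩)
  · rintro ⟨p, hp, q, hq, hpq, rfl⟩
    exact ⟨(⟨p, hp⟩, ⟨q, hq⟩), rfl⟩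
  · rintro ⟨⟨p, q⟩, rfl⟩
    exact ⟨p, p.2, q, q.2, hXY _ p.2 _ q.2, rfl⟩

theorem continuous_mk_linearMap {m : ℕ} (φ : (Fin (n + 1) → K) →ₗ[K] Fin (m + 1) → K)
    (hφ : ∀ p : X, φ p.1.rep ≠ 0) :
    Continuous fun p : X => (Projectivization.mk K (φ p.1.rep) (hφ p) : PSpace K m) := by
  refine continuous_iff_isClosed.2 fun Z hZ => ?_
  obtain ⟨T, hT, rfl⟩ := isClosed_iff.1 hZ
  let pullback (f : MvPolynomial (Fin (m + 1)) K) : MvPolynomial (Fin (n + 1)) K :=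
    bind₁ (LinearMap.toMatrix' φ).toMvPolynomial f
  have hform : ∀ g ∈ pullback '' T, IsForm g := by
    rintro _ ⟨f, hf, rfl⟩
    obtain ⟨d, hd⟩ := hT f hf
    exact ⟨1 * d, hd.aeval _ (Matrix.toMvPolynomial_isHomogeneous _)⟩
  have heval (x : Fin (n + 1) → K) (f : MvPolynomial (Fin (m + 1)) K) :
      eval x (pullback f) = eval (φ x) f := by
    rw [← aeval_eq_eval, ← aeval_eq_eval]
    simp only [pullback, aeval_bind₁]
    simp only [aeval_eq_eval, Matrix.toMvPolynomial_eval_eq_apply, LinearMap.toMatrix'_mulVec]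
  convert (isClosed_zeros hform).preimage continuous_subtype_val using 1
  ext p
  simp only [zeros, Set.mem_preimage, Set.mem_ofPred_eq, Set.forall_mem_image, heval]
  exact forall₂_congr fun f hf => eval_mk_rep_eq_zero_iff (hT f hf) (hφ p)

theorem isVariety_hadamard (hX : IsIrreducible X) (hY : IsIrreducible Y)
    (hXY : ∀ p ∈ X, ∀ q ∈ Y, p.rep * q.rep ≠ 0) : IsVariety (hadamard X Y) := by
  have := Subtype.irreducibleSpace hX
  have := Subtype.irreducibleSpace hY
  refine ⟨isClosed_closure, ?_⟩
  rw [hadamard_eq_closure_range hXY]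
  refine (isIrreducible_range_uncurry (f := fun (p : X) (q : Y) =>
    Projectivization.mk K (p.1.rep * q.1.rep) (hXY _ p.2 _ q.2)) (fun q => ?_) fun p => ?_).closure
  · exact continuous_mk_linearMap (LinearMap.mulRight K q.1.rep) fun p => hXY _ p.2 _ q.2
  · exact continuous_mk_linearMap (LinearMap.mulLeft K p.1.rep) fun q => hXY _ p.2 _ q.2

variable {L L' : Submodule K (Fin (n + 1) → K)}

theorem rep_mem_of_subset_linearSubspace (hX : X ⊆ linearSubspace L) {p : PSpace K n}
    (hp : p ∈ X) : p.rep ∈ L := by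
  have hle : p.submodule ≤ L := hX hp
  rw [Projectivization.submodule_eq] at hle
  exact hle (Submodule.mem_span_singleton_self _)

theorem rep_mul_rep_ne_zero (h : L.LinearDisjoint L') (hX : X ⊆ linearSubspace L)
    (hY : Y ⊆ linearSubspace L') : ∀ p ∈ X, ∀ q ∈ Y, p.rep * q.rep ≠ 0 := fun p hp q hq =>
  mul_ne_zero_of_linearDisjoint h (rep_mem_of_subset_linearSubspace hX hp)
    (rep_mem_of_subset_linearSubspace hY hq) p.rep_nonzero q.rep_nonzero

theorem HF_hadamard (h : L.LinearDisjoint L') (hXL : X ⊆ linearSubspace L)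
    (hYL : Y ⊆ linearSubspace L') (hX : X.Nonempty) (hY : Y.Nonempty) (t : ℕ) :
    HF (hadamard X Y) t = HF X t * HF Y t := by
  have := hX.to_subtype
  have := hY.to_subtype
  rw [hadamard_eq_closure_range (rep_mul_rep_ne_zero h hXL hYL), HF_closure, HF_range_mk,
    HF_eq_finrank_coordSpan_rep_pow X, HF_eq_finrank_coordSpan_rep_pow Y]
  exact finrank_coordSpan_mul_pow h (fun p => rep_mem_of_subset_linearSubspace hXL p.2)
    (fun q => rep_mem_of_subset_linearSubspace hYL q.2) t

theorem hilbertPolynomial_hadamard (h : L.LinearDisjoint L') (hXL : X ⊆ linearSubspace L)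
    (hYL : Y ⊆ linearSubspace L') (hX : X.Nonempty) (hY : Y.Nonempty) :
    hilbertPolynomial (hadamard X Y) = hilbertPolynomial X * hilbertPolynomial Y := by
  refine (isHilbertPolynomial_hilbertPolynomial (hadamard X Y)).unique ?_
  filter_upwards [isHilbertPolynomial_hilbertPolynomial X,
    isHilbertPolynomial_hilbertPolynomial Y] with t htX htY
  rw [Polynomial.eval_mul, ← htX, ← htY, ← Nat.cast_mul]
  exact congrArg _ (HF_hadamard h hXL hYL hX hY t)

end Hadamard

section Genericity

theorem linearDisjoint_span_range {K A ι κ : Type*} [Field K] [CommRing A] [Algebra K A]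
    {u : ι → A} {w : κ → A} (hu : LinearIndependent K u) (hw : LinearIndependent K w)
    (huw : LinearIndependent K fun x : ι × κ => u x.1 * w x.2) :
    (Submodule.span K (Set.range u)).LinearDisjoint (Submodule.span K (Set.range w)) := by
  refine Submodule.LinearDisjoint.of_basis_mul _ _ (Module.Basis.span hu) (Module.Basis.span hw) ?_
  simpa only [Module.Basis.span_apply] using huw

variable {R σ ι κ : Type*} [CommRing R] [Fintype ι] [Fintype κ] [DecidableEq ι] [DecidableEq κ]

/-- For generic matrices `A` and `B`, whose entries are the variables, this is the minor of the
matrix of all coordinatewise products of a column of `A` with a column of `B` in the rows selected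
by `e`. -/
def hadamardMinor (R : Type*) [CommRing R] (e : ι × κ → σ) :
    MvPolynomial ((σ × ι) ⊕ (σ × κ)) R :=
  (Matrix.of fun x y : ι × κ =>
    (MvPolynomial.X (Sum.inl (e x, y.1)) * MvPolynomial.X (Sum.inr (e x, y.2)) :
      MvPolynomial ((σ × ι) ⊕ (σ × κ)) R)).det

theorem eval_hadamardMinor (e : ι × κ → σ) (A : Matrix σ ι R) (B : Matrix σ κ R) :
    eval (Sum.elim (fun ij => A ij.1 ij.2) fun ij => B ij.1 ij.2) (hadamardMinor R e) =
      (Matrix.of fun x y : ι × κ => A (e x) y.1 * B (e x) y.2).det := by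
  rw [hadamardMinor, RingHom.map_det]
  congr 1
  ext x y
  simp

theorem hadamardMinor_ne_zero [Nontrivial R] {e : ι × κ → σ} (he : e.Injective) :
    hadamardMinor R e ≠ 0 := by
  classical
  intro hzero
  have hone := eval_hadamardMinor e (R := R)
    (fun l a => if ∃ b, e (a, b) = l then 1 else 0)
    (fun l b => if ∃ a, e (a, b) = l then 1 else 0)
  suffices hM : (Matrix.of fun x y : ι × κ => (if ∃ b, e (y.1, b) = e x then (1 : R) else 0) *
      if ∃ a, e (a, y.2) = e x then 1 else 0) = 1 by
    rw [hM, hzero, map_zero, Matrix.det_one] at hone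
    exact zero_ne_one hone
  ext x y
  rw [Matrix.of_apply, mul_comm]
  simp [he.eq_iff, Matrix.one_apply, Prod.ext_iff, ite_and, eq_comm]

theorem linearIndependent_col_mul_col_of_eval_hadamardMinor_ne_zero [IsDomain R] {e : ι × κ → σ}
    {A : Matrix σ ι R} {B : Matrix σ κ R}
    (hAB : eval (Sum.elim (fun ij => A ij.1 ij.2) fun ij => B ij.1 ij.2) (hadamardMinor R e) ≠ 0) :
    LinearIndependent R fun x : ι × κ => A.col x.1 * B.col x.2 := by
  rw [eval_hadamardMinor] at hAB
  exact .of_comp (LinearMap.funLeft R R e) (Matrix.linearIndependent_cols_of_det_ne_zero hAB)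

end Genericity

end HadamardProj

end

theorem mainTheorem2_general (K : Type*) [Field K] [IsAlgClosed K]
    (n h k : ℕ) (hn : (h + 1) * (k + 1) - 1 ≤ n) :
    HadamardProj.ForGenericPair K n h k fun L L' =>
      ∀ X Y : Set (HadamardProj.PSpace K n),
        HadamardProj.IsVariety X → HadamardProj.IsVariety Y → X ⊆ L → Y ⊆ L' →
        ∀ r s : ℕ, HadamardProj.dim X = r → HadamardProj.dim Y = s →
          HadamardProj.dim (HadamardProj.hadamard X Y) = ((r + s : ℕ) : WithBot ℕ∞) ∧
          HadamardProj.degree (HadamardProj.hadamard X Y) =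
            ((r + s).choose s : ℚ) * HadamardProj.degree X * HadamardProj.degree Y ∧
          ∀ t : ℕ, HadamardProj.HF (HadamardProj.hadamard X Y) t =
            HadamardProj.HF X t * HadamardProj.HF Y t := by
  open HadamardProj in
  obtain ⟨e⟩ : Nonempty (Fin (h + 1) × Fin (k + 1) ↪ Fin (n + 1)) :=
    Function.Embedding.nonempty_of_card_le <| by
      simp only [Fintype.card_prod, Fintype.card_fin]
      omega
  refine ⟨hadamardMinor K e, hadamardMinor_ne_zero e.injective,
    fun A B hA hB hAB X Y hX hY hXL hYL r s hr hs => ?_⟩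
  have hLL' : (colSpace A).LinearDisjoint (colSpace B) :=
    linearDisjoint_span_range hA hB
      (linearIndependent_col_mul_col_of_eval_hadamardMinor_ne_zero hAB)
  have hXY := isVariety_hadamard hX.2 hY.2 (rep_mul_rep_ne_zero hLL' hXL hYL)
  have hP := hilbertPolynomial_hadamard hLL' hXL hYL hX.2.nonempty hY.2.nonempty
  have hPX := hilbertPolynomial_ne_zero hX.2
  have hPY := hilbertPolynomial_ne_zero hY.2
  obtain rfl : _ = r := by exact_mod_cast (dim_eq_natDegree_hilbertPolynomial hX).symm.trans hr
  obtain rfl : _ = s := by exact_mod_cast (dim_eq_natDegree_hilbertPolynomial hY).symm.trans hs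
  refine ⟨?_, ?_, HF_hadamard hLL' hXL hYL hX.2.nonempty hY.2.nonempty⟩
  · rw [dim_eq_natDegree_hilbertPolynomial hXY, hP, Polynomial.natDegree_mul hPX hPY]
  · rw [degree_eq_factorial_mul_leadingCoeff hXY, degree_eq_factorial_mul_leadingCoeff hX,
      degree_eq_factorial_mul_leadingCoeff hY, hP, Polynomial.natDegree_mul hPX hPY,
      Polynomial.leadingCoeff_mul, ← Nat.add_choose_mul_factorial_mul_factorial]
    push_cast
    ring

theorem mainTheorem2 (K : Type*) [Field K] [IsAlgClosed K] [CharZero K]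
    (n h k : ℕ) (hn : (h + 1) * (k + 1) - 1 ≤ n) :
    HadamardProj.ForGenericPair K n h k fun L L' =>
      ∀ X Y : Set (HadamardProj.PSpace K n),
        HadamardProj.IsVariety X → HadamardProj.IsVariety Y → X ⊆ L → Y ⊆ L' →
        ∀ r s : ℕ, HadamardProj.dim X = r → HadamardProj.dim Y = s →
          HadamardProj.dim (HadamardProj.hadamard X Y) = ((r + s : ℕ) : WithBot ℕ∞) ∧
          HadamardProj.degree (HadamardProj.hadamard X Y) =
            ((r + s).choose s : ℚ) * HadamardProj.degree X * HadamardProj.degree Y ∧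
          ∀ t : ℕ, HadamardProj.HF (HadamardProj.hadamard X Y) t =
            HadamardProj.HF X t * HadamardProj.HF Y t :=
  mainTheorem2_general K n h k hn
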